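/- Let $(\Omega,\mathcal F,P)$ be a probability space (it need not be complete) and write $L^\infty(P)=L^\infty(\Omega,\mathcal F,P)$. A map $\rho:L^\infty(P)\to\mathbb R$ is called a convex risk measure if, for all $X,Y\in L^\infty(P)$: - (monotonicity) $X\le Y$ $P$-a.s. implies $\rho(X)\ge\rho(Y)$; - (translation invariance) $\rho(X+m)=\rho(X)-m$ for every $m\in\mathbb R$; - (convexity) $\rho(tX+(1-t)Y)\le t\rho(X)+(1-t)\rho(Y)$ for every $t\in[0,1]$. Let $\mathscr M_{1,f}(P)$ be the set of all finitely additive probability measures $Q$ on $(\Omega,\mathcal F)$ that are absolutely continuous with respect to $P$, i.e. $Q(A)=0$ whenever $A\in\mathcal F$ and $P(A)=0$. For $X\in L^\infty(P)$ let $E_Q[X]$ denote the integral of $X$ with respect to $Q$. Equip $\mathscr M_{1,f}(P)$ with the weak* topology induced by $L^\infty(P)$, i.e. the coarsest topology for which $Q\mapsto E_Q[X]$ is continuous for every $X\in L^\infty(P)$. **Corollary.** Let $\rho:L^\infty(P)\to\mathbb R$ be a convex risk measure. Then there exists a functional $\alpha:\mathscr M_{1,f}(P)\to(-\infty,\infty]$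 that is convex and lower semicontinuous for the weak* topology, such that $$\rho(X)=\max_{Q\in\mathscr M_{1,f}(P)}\bigl(E_Q[-X]-\alpha(Q)\bigr)\qquad\text{for all }X\in L^\infty(P),$$ where the maximum is attained for every $X$. -/

import Mathlib

open MeasureTheory Set
open scoped ENNReal

/-- A monetary risk measure on `L^∞(P)`: monotone and translation-invariant. -/
structure IsMonetaryRiskMeasure {Ω : Type*} [MeasurableSpace Ω] {P : Measure Ω}
    [IsProbabilityMeasure P] (ρ : Lp ℝ ∞ P → ℝ) : Prop where
  monotonicity : ∀ X Y : Lp ℝ ∞ P, (∀ᵐ ω ∂P, X ω ≤ Y ω) → ρ Y ≤ ρ X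
  translation_invariance : ∀ (X : Lp ℝ ∞ P) (m : ℝ), ρ (X + Lp.const ∞ P m) = ρ X - m

/-- A convex risk measure on `L^∞(P)`: a monetary risk measure that is convex. -/
structure IsConvexRiskMeasure {Ω : Type*} [MeasurableSpace Ω] {P : Measure Ω}
    [IsProbabilityMeasure P] (ρ : Lp ℝ ∞ P → ℝ) : Prop extends IsMonetaryRiskMeasure ρ where
  convexity : ∀ (X Y : Lp ℝ ∞ P) (t : ℝ), t ∈ Icc (0 : ℝ) 1 →
    ρ (t • X + (1 - t) • Y) ≤ t * ρ X + (1 - t) * ρ Y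

/-- The finitely additive probability measures `Q` on the σ-algebra of `Ω` which are absolutely
continuous with respect to `P`. Only the values on measurable sets matter; as for Mathlib's vector
measures, the value on a nonmeasurable set is `0` by convention. -/
structure FinAddProb {Ω : Type*} [MeasurableSpace Ω] (P : Measure Ω)
    extends AddContent ℝ {s : Set Ω | MeasurableSet s} where
  not_measurable' : ∀ s : Set Ω, ¬ MeasurableSet s → toFun s = 0
  nonneg' : ∀ s : Set Ω, MeasurableSet s → 0 ≤ toFun s
  univ' : toFun univ = 1
  absolutelyContinuous' : ∀ s : Set Ω, MeasurableSet s → P s = 0 → toFun s = 0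

namespace FinAddProb

/-- A finitely additive probability as a set function. -/
instance {Ω : Type*} [MeasurableSpace Ω] {P : Measure Ω} :
    CoeFun (FinAddProb P) (fun _ => Set Ω → ℝ) := ⟨fun Q => Q.toFun⟩

/-- The elementary integral `∑ y, y * Q (s = y)` of a simple function `s`. -/
noncomputable def simpleIntegral {Ω : Type*} [MeasurableSpace Ω] {P : Measure Ω}
    (Q : FinAddProb P) (s : SimpleFunc Ω ℝ) : ℝ :=
  ∑ y ∈ s.range, y * Q (s ⁻¹' {y})

/-- The expectation `E_Q[X]` of `X ∈ L^∞(P)`: the supremum of the integrals of the simple functions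
that are `P`-a.s. below `X`. As `X` is a.s. a uniform limit of simple functions and `Q` vanishes on
`P`-null sets, this is the usual integral with respect to a finitely additive measure. -/
noncomputable def expect {Ω : Type*} [MeasurableSpace Ω] {P : Measure Ω}
    (Q : FinAddProb P) (X : Lp ℝ ∞ P) : ℝ :=
  sSup {r : ℝ | ∃ s : SimpleFunc Ω ℝ, (∀ᵐ ω ∂P, s ω ≤ X ω) ∧ r = Q.simpleIntegral s}

/-- The weak* topology induced by `L^∞(P)`: the coarsest topology that makes `Q ↦ E_Q[X]`
continuous for every `X ∈ L^∞(P)`. -/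
noncomputable instance {Ω : Type*} [MeasurableSpace Ω] {P : Measure Ω} :
    TopologicalSpace (FinAddProb P) :=
  ⨅ X : Lp ℝ ∞ P, TopologicalSpace.induced (fun Q => Q.expect X) inferInstance

/-- The convex combination `t Q + (1 - t) R` for `t ∈ [0, 1]`. -/
def mix {Ω : Type*} [MeasurableSpace Ω] {P : Measure Ω} (t : ℝ) (ht : t ∈ Icc (0 : ℝ) 1)
    (Q R : FinAddProb P) : FinAddProb P where
  toFun s := t * Q s + (1 - t) * R s
  empty' := by simp [Q.empty', R.empty']
  sUnion' I h₁ h₂ h₃ := by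
    rw [Q.sUnion' I h₁ h₂ h₃, R.sUnion' I h₁ h₂ h₃, Finset.mul_sum, Finset.mul_sum,
      ← Finset.sum_add_distrib]
  not_measurable' s hs := by simp [Q.not_measurable' s hs, R.not_measurable' s hs]
  nonneg' s hs := add_nonneg (mul_nonneg ht.1 (Q.nonneg' s hs))
    (mul_nonneg (sub_nonneg.2 ht.2) (R.nonneg' s hs))
  univ' := by rw [Q.univ', R.univ']; ring
  absolutelyContinuous' s hs h := by
    simp [Q.absolutelyContinuous' s hs h, R.absolutelyContinuous' s hs h]

/-- Convexity of a functional on the finitely additive probabilities with values in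
`(-∞, ∞]` (in `EReal`, `0 * ⊤ = 0`). -/
def IsConvexFunctional {Ω : Type*} [MeasurableSpace Ω] {P : Measure Ω}
    (α : FinAddProb P → EReal) : Prop :=
  ∀ (Q R : FinAddProb P) (t : ℝ) (ht : t ∈ Icc (0 : ℝ) 1),
    α (mix t ht Q R) ≤ (t : EReal) * α Q + ((1 - t : ℝ) : EReal) * α R

end FinAddProb

/-! Take `α` to be the conjugate penalty `α Q = sup_X (E_Q[-X] - ρ X)`. As a supremum of weak*
continuous functions affine in `Q`, it is lower semicontinuous and convex, and `E_Q[-X] - α Q ≤ ρ X`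
holds by construction. Attainment at `X` comes from a subgradient `g` of `ρ` at `X`, given by
algebraic Hahn–Banach (`ConvexOn.exists_linearMap_le_sub`); no compactness is needed. Monotonicity
makes `-g` positive and translation invariance normalises it, so `-g = E_Q` for some `Q`
(`expect_ofLinearMap`). The subgradient inequality then says that the supremum defining `α Q` is
attained at `X`. -/

/-- A finite convex function on a real vector space has a subgradient at every point. -/
theorem ConvexOn.exists_linearMap_le_sub {E : Type*} [AddCommGroup E] [Module ℝ E] {f : E → ℝ}
    (hf : ConvexOn ℝ univ f) (x : E) : ∃ g : E →ₗ[ℝ] ℝ, ∀ y, g y ≤ f (x + y) - f x := by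
  -- The one-sided directional derivative of `f` at `x`, written as an infimum of difference
  -- quotients; it is sublinear.
  set N : E → ℝ := fun z => ⨅ t : Ioi (0 : ℝ), (f (x + (t : ℝ) • z) - f x) / t with hN
  have hbdd : ∀ z, BddBelow (range fun t : Ioi (0 : ℝ) => (f (x + (t : ℝ) • z) - f x) / t) := by
    intro z
    -- Convexity applies because `x` lies between `x + t • z` and `x - z`.
    refine ⟨f x - f (x - z), ?_⟩
    rintro _ ⟨⟨t, ht⟩, rfl⟩
    have ht : 0 < t := ht
    have h := hf.2 (mem_univ (x + t • z)) (mem_univ (x - z))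
      (show 0 ≤ 1 / (1 + t) by positivity) (show 0 ≤ t / (1 + t) by positivity) (by field_simp)
    have hx : (1 / (1 + t)) • (x + t • z) + (t / (1 + t)) • (x - z) = x := by
      match_scalars <;> field_simp
      ring
    rw [hx, smul_eq_mul, smul_eq_mul, ← mul_le_mul_iff_right₀ (show 0 < 1 + t by positivity)] at h
    field_simp at h
    rw [le_div_iff₀ ht]
    linarith
  have hle : ∀ z t, 0 < t → N z ≤ (f (x + t • z) - f x) / t := fun z t ht =>
    ciInf_le (hbdd z) (⟨t, ht⟩ : Ioi (0 : ℝ))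
  have hne : Nonempty (Ioi (0 : ℝ)) := ⟨⟨1, mem_Ioi.2 zero_lt_one⟩⟩
  have hsmul : ∀ c : ℝ, 0 < c → ∀ z, N (c • z) ≤ c * N z := by
    intro c hc z
    rw [hN]
    simp only
    rw [Real.mul_iInf_of_nonneg hc.le]
    refine le_ciInf fun ⟨t, ht⟩ => ?_
    have ht : 0 < t := ht
    refine (hle _ (t / c) (div_pos ht hc)).trans_eq ?_
    rw [smul_smul, div_mul_cancel₀ _ hc.ne']
    field_simp
  have hadd : ∀ y z, N (y + z) ≤ N y + N z := by
    intro y z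
    refine le_ciInf_add_ciInf fun ⟨s, hs⟩ ⟨t, ht⟩ => ?_
    have hs : 0 < s := hs
    have ht : 0 < t := ht
    -- With this step size, `x` moved along `y + z` is a convex combination of `x + s • y` and `x +
    -- t • z`.
    refine (hle _ (s * t / (s + t)) (by positivity)).trans ?_
    have h := hf.2 (mem_univ (x + s • y)) (mem_univ (x + t • z))
      (show 0 ≤ t / (s + t) by positivity) (show 0 ≤ s / (s + t) by positivity) (by field_simp; ring)
    have hx : (t / (s + t)) • (x + s • y) + (s / (s + t)) • (x + t • z)
        = x + (s * t / (s + t)) • (y + z) := by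
      match_scalars <;> field_simp
      ring
    rw [hx, smul_eq_mul, smul_eq_mul] at h
    rw [div_le_iff₀ (by positivity)]
    have e : ((f (x + s • y) - f x) / s + (f (x + t • z) - f x) / t) * (s * t / (s + t))
        = t / (s + t) * f (x + s • y) + s / (s + t) * f (x + t • z) - f x := by
      field_simp
      ring
    simp only
    linarith
  have hhom : ∀ c : ℝ, 0 < c → ∀ z, N (c • z) = c * N z := by
    intro c hc z
    refine le_antisymm (hsmul c hc z) ?_
    have h := hsmul c⁻¹ (inv_pos.2 hc) (c • z)
    rw [inv_smul_smul₀ hc.ne', inv_mul_eq_div, le_div_iff₀ hc] at h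
    linarith
  have h0 : N 0 = 0 := by simp [hN]
  obtain ⟨g, -, hg⟩ := exists_extension_of_le_sublinear (⊥ : E →ₗ.[ℝ] ℝ) N hhom hadd (by
    rintro ⟨z, hz⟩
    obtain rfl : z = 0 := (Submodule.mem_bot ℝ).1 hz
    rw [h0]
    exact (map_zero (⊥ : E →ₗ.[ℝ] ℝ).toFun).le)
  exact ⟨g, fun y => (hg y).trans (by simpa using hle y 1 one_pos)⟩

/-! ### Integration against a finitely additive probability. -/

namespace FinAddProb

variable {Ω : Type*} [MeasurableSpace Ω] {P : Measure Ω}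

/-- The set function `s ↦ Q s • id`, for which `setToSimpleFunc` is the elementary integral. -/
noncomputable def toCLM (Q : FinAddProb P) (s : Set Ω) : ℝ →L[ℝ] ℝ :=
  Q s • ContinuousLinearMap.id ℝ ℝ

theorem simpleIntegral_eq (Q : FinAddProb P) (s : SimpleFunc Ω ℝ) :
    Q.simpleIntegral s = s.setToSimpleFunc Q.toCLM := by
  simp [simpleIntegral, SimpleFunc.setToSimpleFunc, toCLM, mul_comm]

theorem apply_union (Q : FinAddProb P) {s t : Set Ω} (hs : MeasurableSet s) (ht : MeasurableSet t)
    (hst : Disjoint s t) : Q (s ∪ t) = Q s + Q t :=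
  addContent_union' (m := Q.toAddContent) hs ht (hs.union ht) hst

theorem finMeasAdditive_toCLM (Q : FinAddProb P) : FinMeasAdditive P Q.toCLM := by
  intro s t hs ht _ _ hst
  rw [toCLM, Q.apply_union hs ht hst, add_smul]
  rfl

theorem simpleIntegral_indicator (Q : FinAddProb P) (c : ℝ) {A : Set Ω} (hA : MeasurableSet A) :
    Q.simpleIntegral (SimpleFunc.piecewise A hA (SimpleFunc.const Ω c) (SimpleFunc.const Ω 0))
      = c * Q A := by
  rw [simpleIntegral_eq]
  refine (SimpleFunc.setToSimpleFunc_indicator _ Q.finMeasAdditive_toCLM.map_empty_eq_zero hA c).trans ?_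
  simp [toCLM, mul_comm]

theorem simpleIntegral_const (Q : FinAddProb P) (c : ℝ) :
    Q.simpleIntegral (SimpleFunc.const Ω c) = c := by
  have h := Q.simpleIntegral_indicator c MeasurableSet.univ
  rwa [SimpleFunc.piecewise_univ, Q.univ', mul_one] at h

theorem simpleIntegral_nonneg (Q : FinAddProb P) {s : SimpleFunc Ω ℝ} (hs : ∀ᵐ ω ∂P, 0 ≤ s ω) :
    0 ≤ Q.simpleIntegral s := by
  refine Finset.sum_nonneg fun y _ => ?_
  rcases le_or_gt 0 y with hy | hy
  · exact mul_nonneg hy (Q.nonneg' _ (s.measurableSet_fiber y))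
  -- A negative value is taken only on a `P`-null fibre.
  · rw [Q.absolutelyContinuous' _ (s.measurableSet_fiber y), mul_zero]
    refine measure_mono_null (fun ω hω => ?_) (ae_iff.1 hs)
    have : s ω = y := hω
    simpa [this] using hy

theorem simpleIntegral_mix (t : ℝ) (ht : t ∈ Icc (0 : ℝ) 1) (Q R : FinAddProb P)
    (s : SimpleFunc Ω ℝ) :
    (mix t ht Q R).simpleIntegral s = t * Q.simpleIntegral s + (1 - t) * R.simpleIntegral s := by
  simp only [simpleIntegral, Finset.mul_sum, ← Finset.sum_add_distrib]
  refine Finset.sum_congr rfl fun y _ => ?_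
  change y * (t * Q _ + (1 - t) * R _) = _
  ring

theorem continuous_expect (X : Lp ℝ ∞ P) : Continuous fun Q : FinAddProb P => Q.expect X :=
  continuous_iff_le_induced.2 (iInf_le _ X)

section Integral

variable [IsProbabilityMeasure P]

theorem simpleIntegral_add (Q : FinAddProb P) (s t : SimpleFunc Ω ℝ) :
    Q.simpleIntegral (s + t) = Q.simpleIntegral s + Q.simpleIntegral t := by
  simp only [simpleIntegral_eq]
  exact SimpleFunc.setToSimpleFunc_add _ Q.finMeasAdditive_toCLM s.integrable_of_isFiniteMeasure
    t.integrable_of_isFiniteMeasure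

theorem simpleIntegral_sub (Q : FinAddProb P) (s t : SimpleFunc Ω ℝ) :
    Q.simpleIntegral (s - t) = Q.simpleIntegral s - Q.simpleIntegral t := by
  simp only [simpleIntegral_eq]
  exact SimpleFunc.setToSimpleFunc_sub _ Q.finMeasAdditive_toCLM s.integrable_of_isFiniteMeasure
    t.integrable_of_isFiniteMeasure

theorem simpleIntegral_mono (Q : FinAddProb P) {s t : SimpleFunc Ω ℝ}
    (h : ∀ᵐ ω ∂P, s ω ≤ t ω) : Q.simpleIntegral s ≤ Q.simpleIntegral t := by
  rw [← sub_nonneg, ← simpleIntegral_sub]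
  exact Q.simpleIntegral_nonneg (h.mono fun ω hω => by simpa using hω)

end Integral

/-- Every element of `L^∞(P)` is a.s. a uniform limit of simple functions. -/
theorem exists_simpleFunc_le_le_add (X : Lp ℝ ∞ P) {ε : ℝ} (hε : 0 < ε) :
    ∃ s : SimpleFunc Ω ℝ, (∀ᵐ ω ∂P, s ω ≤ X ω) ∧ ∀ᵐ ω ∂P, X ω ≤ s ω + ε := by
  set M : ℝ := (eLpNorm X ∞ P).toReal
  have hM : 0 ≤ M := ENNReal.toReal_nonneg
  have hX : ∀ᵐ ω ∂P, ‖X ω‖ ≤ M := by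
    filter_upwards [ae_le_eLpNormEssSup (f := X) (μ := P)] with ω hω
    rw [← eLpNorm_exponent_top] at hω
    exact (toReal_enorm (X ω)).symm.trans_le (ENNReal.toReal_mono (Lp.eLpNorm_ne_top X) hω)
  -- Truncating the representative everywhere leaves finitely many values of `⌊g / ε⌋`.
  set g : Ω → ℝ := fun ω => max (-M) (min M (X ω)) with hg
  have hgm : Measurable g :=
    measurable_const.max (measurable_const.min (Lp.stronglyMeasurable X).measurable)
  have hgX : ∀ᵐ ω ∂P, g ω = X ω := by
    filter_upwards [hX] with ω hω
    rw [Real.norm_eq_abs, abs_le] at hω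
    simp [hg, hω.1, hω.2]
  have hfm : Measurable fun ω => ⌊g ω / ε⌋ := (hgm.div_const ε).floor
  have hfin : (range fun ω => ⌊g ω / ε⌋).Finite := by
    refine (finite_Icc ⌊-M / ε⌋ ⌊M / ε⌋).subset ?_
    rintro _ ⟨ω, rfl⟩
    constructor <;> refine Int.floor_le_floor ?_ <;> gcongr
    · exact le_max_left _ _
    · exact max_le (by linarith) (min_le_left _ _)
  let f : SimpleFunc Ω ℤ := ⟨fun ω => ⌊g ω / ε⌋, fun z => hfm (measurableSet_singleton z), hfin⟩
  refine ⟨f.map fun z : ℤ => ε * (z : ℝ), ?_, ?_⟩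
  · filter_upwards [hgX] with ω hω
    rw [← hω]
    change ε * (⌊g ω / ε⌋ : ℝ) ≤ g ω
    rw [mul_comm, ← le_div_iff₀ hε]
    exact Int.floor_le _
  · filter_upwards [hgX] with ω hω
    have h := (Int.lt_floor_add_one (g ω / ε)).le
    rw [div_le_iff₀ hε] at h
    rw [← hω]
    refine h.trans_eq ?_
    change _ = ε * (⌊g ω / ε⌋ : ℝ) + ε
    ring

variable [IsProbabilityMeasure P]

/-- Pins the supremum within `ε` of a simple integral, so identities for `expect` reduce to simple
functions. -/
theorem le_expect_le_add (Q : FinAddProb P) {X : Lp ℝ ∞ P} {s : SimpleFunc Ω ℝ} {ε : ℝ}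
    (h₁ : ∀ᵐ ω ∂P, s ω ≤ X ω) (h₂ : ∀ᵐ ω ∂P, X ω ≤ s ω + ε) :
    Q.simpleIntegral s ≤ Q.expect X ∧ Q.expect X ≤ Q.simpleIntegral s + ε := by
  have hub : ∀ r ∈ {r : ℝ | ∃ u : SimpleFunc Ω ℝ, (∀ᵐ ω ∂P, u ω ≤ X ω) ∧ r = Q.simpleIntegral u},
      r ≤ Q.simpleIntegral s + ε := by
    rintro _ ⟨u, hu, rfl⟩
    rw [← Q.simpleIntegral_const ε, ← simpleIntegral_add]
    refine Q.simpleIntegral_mono ?_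
    filter_upwards [hu, h₂] with ω hu h₂
    exact hu.trans h₂
  exact ⟨le_csSup ⟨_, hub⟩ ⟨s, h₁, rfl⟩, csSup_le ⟨_, s, h₁, rfl⟩ hub⟩

theorem expect_mix (t : ℝ) (ht : t ∈ Icc (0 : ℝ) 1) (Q R : FinAddProb P) (X : Lp ℝ ∞ P) :
    (mix t ht Q R).expect X = t * Q.expect X + (1 - t) * R.expect X := by
  refine eq_of_forall_dist_le fun ε hε => ?_
  obtain ⟨s, h₁, h₂⟩ := exists_simpleFunc_le_le_add X hε
  obtain ⟨a, a'⟩ := (mix t ht Q R).le_expect_le_add h₁ h₂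
  obtain ⟨b, b'⟩ := Q.le_expect_le_add h₁ h₂
  obtain ⟨c, c'⟩ := R.le_expect_le_add h₁ h₂
  rw [simpleIntegral_mix] at a a'
  have ht' := sub_nonneg.2 ht.2
  have := mul_le_mul_of_nonneg_left b ht.1
  have := mul_le_mul_of_nonneg_left b' ht.1
  have := mul_le_mul_of_nonneg_left c ht'
  have := mul_le_mul_of_nonneg_left c' ht'
  rw [Real.dist_eq, abs_le]
  constructor <;> linarith

/-! ### Positive normalised functionals as expectations. -/

open Classical in
/-- The finitely additive probability `A ↦ ℓ 1_A` of a normalised positive linear functional. -/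
noncomputable def ofLinearMap (ℓ : Lp ℝ ∞ P →ₗ[ℝ] ℝ)
    (hpos : ∀ X : Lp ℝ ∞ P, (∀ᵐ ω ∂P, 0 ≤ X ω) → 0 ≤ ℓ X) (hone : ℓ (Lp.const ∞ P 1) = 1) :
    FinAddProb P where
  toFun s := if hs : MeasurableSet s then ℓ (indicatorConstLp ∞ hs (measure_ne_top P s) 1) else 0
  empty' := by
    rw [dif_pos MeasurableSet.empty, indicatorConstLp_empty, map_zero]
  sUnion' I hI hdis _ := by
    induction I using Finset.induction_on with
    | empty => simp
    | insert a I ha ih =>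
      have hIm : ∀ u ∈ I, MeasurableSet u := fun u hu => hI (by simp [hu])
      have ham : MeasurableSet a := hI (by simp)
      have hU : MeasurableSet (⋃₀ (I : Set (Set Ω))) :=
        MeasurableSet.sUnion I.countable_toSet fun u hu => hIm u hu
      have hd : Disjoint a (⋃₀ (I : Set (Set Ω))) := by
        refine disjoint_sUnion_right.2 fun u hu => hdis (by simp) (by simp [hu]) ?_
        rintro rfl
        exact ha hu
      rw [Finset.sum_insert ha, ← ih (fun u hu => hIm u hu)
        (hdis.subset (by simp)) hU, dif_pos hU, dif_pos ham, ← map_add,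
        ← indicatorConstLp_disjoint_union ham hU (measure_ne_top _ _) (measure_ne_top _ _) hd,
        dif_pos (by simpa using ham.union hU)]
      congr 2
      simp
  not_measurable' s hs := dif_neg hs
  nonneg' s hs := by
    rw [dif_pos hs]
    refine hpos _ ?_
    filter_upwards [indicatorConstLp_coeFn (p := ∞) (hs := hs) (hμs := measure_ne_top P s)
      (c := (1 : ℝ))] with ω hω
    rw [hω]
    exact indicator_nonneg (fun _ _ => zero_le_one) ω
  univ' := by
    rw [dif_pos MeasurableSet.univ, indicatorConstLp_univ, hone]
  absolutelyContinuous' s hs h := by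
    rw [dif_pos hs]
    have : indicatorConstLp ∞ hs (measure_ne_top P s) (1 : ℝ) = 0 := by
      rw [← indicatorConstLp_empty (p := ∞) (μ := P) (c := (1 : ℝ)),
        indicatorConstLp_inj hs _ _ _ one_ne_zero]
      exact ae_eq_empty.2 h
    rw [this, map_zero]

theorem ofLinearMap_apply (ℓ : Lp ℝ ∞ P →ₗ[ℝ] ℝ)
    (hpos : ∀ X : Lp ℝ ∞ P, (∀ᵐ ω ∂P, 0 ≤ X ω) → 0 ≤ ℓ X) (hone : ℓ (Lp.const ∞ P 1) = 1)
    {A : Set Ω} (hA : MeasurableSet A) :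
    ofLinearMap ℓ hpos hone A = ℓ (indicatorConstLp ∞ hA (measure_ne_top P A) 1) :=
  dif_pos hA

variable {ℓ : Lp ℝ ∞ P →ₗ[ℝ] ℝ} (hpos : ∀ X : Lp ℝ ∞ P, (∀ᵐ ω ∂P, 0 ≤ X ω) → 0 ≤ ℓ X)
  (hone : ℓ (Lp.const ∞ P 1) = 1)

theorem simpleIntegral_ofLinearMap (s : SimpleFunc Ω ℝ) :
    (ofLinearMap ℓ hpos hone).simpleIntegral s = ℓ ((s.memLp_top P).toLp s) := by
  induction s using SimpleFunc.induction with
  | @const c A hA =>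
    rw [simpleIntegral_indicator, ofLinearMap_apply _ _ _ hA, ← smul_eq_mul, ← map_smul]
    congr 1
    rw [indicatorConstLp, ← MemLp.toLp_const_smul]
    refine MemLp.toLp_congr _ _ (.of_forall fun ω => ?_)
    by_cases hω : ω ∈ A <;> simp [hω, indicator]
  | add _ hf hg =>
    rw [simpleIntegral_add, hf, hg, ← map_add]
    rfl

theorem expect_ofLinearMap (X : Lp ℝ ∞ P) : (ofLinearMap ℓ hpos hone).expect X = ℓ X := by
  refine eq_of_forall_dist_le fun ε hε => ?_
  obtain ⟨s, h₁, h₂⟩ := exists_simpleFunc_le_le_add X hε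
  obtain ⟨a, b⟩ := (ofLinearMap ℓ hpos hone).le_expect_le_add h₁ h₂
  rw [simpleIntegral_ofLinearMap] at a b
  have hs := (s.memLp_top P).coeFn_toLp
  have c := hpos (X - (s.memLp_top P).toLp s) (by
    filter_upwards [hs, h₁, Lp.coeFn_sub X ((s.memLp_top P).toLp s)] with ω hs h₁ h
    rw [h, Pi.sub_apply, hs]
    linarith)
  have d := hpos ((s.memLp_top P).toLp s + ε • Lp.const ∞ P 1 - X) (by
    filter_upwards [hs, h₂, Lp.coeFn_sub ((s.memLp_top P).toLp s + ε • Lp.const ∞ P 1) X,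
      Lp.coeFn_add ((s.memLp_top P).toLp s) (ε • Lp.const ∞ P 1),
      Lp.coeFn_smul ε (Lp.const ∞ P (1 : ℝ)), Lp.coeFn_const ∞ P (1 : ℝ)] with ω hs h₂ h h' h'' h'''
    rw [h, Pi.sub_apply, h', Pi.add_apply, h'', Pi.smul_apply, h''', hs]
    simp only [Function.const_apply, smul_eq_mul, mul_one]
    linarith)
  simp only [map_sub, map_add, map_smul, hone, smul_eq_mul, mul_one] at c d
  rw [Real.dist_eq, abs_le]
  constructor <;> linarith

end FinAddProb

/-! ### Subgradients of risk measures and the dual representation. -/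

theorem IsConvexRiskMeasure.convexOn {Ω : Type*} [MeasurableSpace Ω] {P : Measure Ω}
    [IsProbabilityMeasure P] {ρ : Lp ℝ ∞ P → ℝ} (hρ : IsConvexRiskMeasure ρ) :
    ConvexOn ℝ univ ρ := by
  refine ⟨convex_univ, fun X _ Y _ a b ha hb hab => ?_⟩
  obtain rfl : b = 1 - a := by linarith
  exact hρ.convexity X Y a ⟨ha, by linarith⟩

/-- A convex risk measure has at every `X` a subgradient of the form `-E_Q`. -/
theorem IsConvexRiskMeasure.exists_expect_neg_sub_le {Ω : Type*} [MeasurableSpace Ω]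
    {P : Measure Ω} [IsProbabilityMeasure P] {ρ : Lp ℝ ∞ P → ℝ} (hρ : IsConvexRiskMeasure ρ)
    (X : Lp ℝ ∞ P) :
    ∃ Q : FinAddProb P, ∀ Y : Lp ℝ ∞ P, Q.expect (-Y) - ρ Y ≤ Q.expect (-X) - ρ X := by
  obtain ⟨g, hg⟩ := hρ.convexOn.exists_linearMap_le_sub X
  have hpos : ∀ Z : Lp ℝ ∞ P, (∀ᵐ ω ∂P, 0 ≤ Z ω) → 0 ≤ (-g) Z := by
    intro Z hZ
    have h := hρ.monotonicity X (X + Z) (by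
      filter_upwards [hZ, Lp.coeFn_add X Z] with ω hω h
      rw [h, Pi.add_apply]
      linarith)
    have := hg Z
    rw [LinearMap.neg_apply]
    linarith
  have hone : (-g) (Lp.const ∞ P 1) = 1 := by
    -- The directions `1` and `-1` bound `g 1` by `-1` from above and from below.
    have h₁ := hg (Lp.const ∞ P 1)
    have h₂ := hg (Lp.const ∞ P (-1))
    rw [hρ.translation_invariance] at h₁ h₂
    rw [map_neg, map_neg] at h₂
    rw [LinearMap.neg_apply]
    linarith
  refine ⟨.ofLinearMap (-g) hpos hone, fun Y => ?_⟩
  have h := hg (Y - X)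
  rw [add_sub_cancel, map_sub] at h
  simp only [FinAddProb.expect_ofLinearMap, LinearMap.neg_apply, map_neg, neg_neg]
  linarith

theorem mainTheorem3 {Ω : Type*} [MeasurableSpace Ω] (P : Measure Ω) [IsProbabilityMeasure P]
    (ρ : Lp ℝ ∞ P → ℝ) (hρ : IsConvexRiskMeasure ρ) :
    ∃ α : FinAddProb P → EReal,
      (∀ Q, α Q ≠ ⊥) ∧ LowerSemicontinuous α ∧ FinAddProb.IsConvexFunctional α ∧
      ∀ X : Lp ℝ ∞ P,
        IsGreatest (range fun Q : FinAddProb P => ((Q.expect (-X) : ℝ) : EReal) - α Q)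
          ((ρ X : ℝ) : EReal) := by
  set α : FinAddProb P → EReal := fun Q => ⨆ X : Lp ℝ ∞ P, ((Q.expect (-X) - ρ X : ℝ) : EReal)
  have hle : ∀ Q X, ((Q.expect (-X) - ρ X : ℝ) : EReal) ≤ α Q := fun Q X =>
    le_iSup (fun X : Lp ℝ ∞ P => ((Q.expect (-X) - ρ X : ℝ) : EReal)) X
  refine ⟨α, fun Q => ?_, ?_, ?_, fun X => ⟨?_, ?_⟩⟩
  · exact ((EReal.bot_lt_coe _).trans_le (hle Q 0)).ne'
  · exact lowerSemicontinuous_iSup fun X => (continuous_coe_real_ereal.comp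
      ((FinAddProb.continuous_expect (-X)).sub continuous_const)).lowerSemicontinuous
  · intro Q R t ht
    refine iSup_le fun X => ?_
    have e : (FinAddProb.mix t ht Q R).expect (-X) - ρ X
        = t * (Q.expect (-X) - ρ X) + (1 - t) * (R.expect (-X) - ρ X) := by
      rw [FinAddProb.expect_mix]
      ring
    rw [e, EReal.coe_add, EReal.coe_mul, EReal.coe_mul]
    exact add_le_add (mul_le_mul_of_nonneg_left (hle Q X) (EReal.coe_nonneg.2 ht.1))
      (mul_le_mul_of_nonneg_left (hle R X) (EReal.coe_nonneg.2 (sub_nonneg.2 ht.2)))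
  · obtain ⟨Q, hQ⟩ := hρ.exists_expect_neg_sub_le X
    have hα : α Q = ((Q.expect (-X) - ρ X : ℝ) : EReal) :=
      le_antisymm (iSup_le fun Y => EReal.coe_le_coe_iff.2 (hQ Y)) (hle Q X)
    refine ⟨Q, ?_⟩
    simp only
    rw [hα, ← EReal.coe_sub, sub_sub_cancel]
  · rintro _ ⟨Q, rfl⟩
    refine (EReal.sub_le_sub le_rfl (hle Q X)).trans_eq ?_
    rw [← EReal.coe_sub, sub_sub_cancel]
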